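/- For a positive integer $n$, let $f(n)$ denote the number of distinct unordered factorisations of $n$ into factors larger than $1$ (that is, the number of multisets of integers larger than $1$ whose product is $n$; $f(1)=1$, from the empty factorisation). Let $\mathcal{B} = \{ n \ge 1 : f(n) \mid n \}$, and for real $x$ let $\mathcal{B}(x) = \{ n \in \mathcal{B} : n \le x\}$. Then $$\#\mathcal{B}(x) = \frac{x}{(\log x)^{1+o(1)}} \qquad \text{as } x \to \infty,$$ that is, there is a function $\varepsilon(x)$ with $\varepsilon(x) \to 0$ as $x \to \infty$ such that $\#\mathcal{B}(x) = x/(\log x)^{1+\varepsilon(x)}$ for all sufficiently large real $x$. -/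

import Mathlib

open Filter Topology

/-- The unordered factorisations of `n` into factors larger than `1`: the multisets of natural
numbers, all larger than `1`, whose product is `n`. (The empty product is the only one for `1`.) -/
def unorderedFactorisations (n : ℕ) : Set (Multiset ℕ) :=
  {s | (∀ a ∈ s, 1 < a) ∧ s.prod = n}

/-- Every natural number has only finitely many unordered factorisations. -/
theorem unorderedFactorisations_finite (n : ℕ) : (unorderedFactorisations n).Finite := by
  refine (Set.finite_Iic (n • n.divisors.val)).subset ?_
  rintro s ⟨h1, rfl⟩
  have h0 : s.prod ≠ 0 := by
    intro h
    exact absurd (h1 0 (Multiset.prod_eq_zero_iff.1 h)) (by omega)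
  refine Multiset.le_iff_count.2 fun a => ?_
  by_cases ha : a ∈ s
  · have hd : a ∈ s.prod.divisors := Nat.mem_divisors.2 ⟨Multiset.dvd_prod ha, h0⟩
    have hp : a ^ s.count a ∣ s.prod := by
      have h := Multiset.prod_dvd_prod_of_le (Multiset.le_count_iff_replicate_le.1 (le_refl (s.count a)))
      rwa [Multiset.prod_replicate] at h
    have hlt : s.count a < s.prod :=
      (Nat.lt_pow_self (h1 a ha)).trans_le (Nat.le_of_dvd (Nat.pos_of_ne_zero h0) hp)
    rw [Multiset.count_nsmul, Multiset.count_eq_one_of_mem s.prod.divisors.nodup hd]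
    omega
  · rw [Multiset.count_eq_zero_of_notMem ha]
    exact Nat.zero_le _

/-- The number `f(n)` of unordered factorisations of `n` into factors larger than `1`. -/
noncomputable def numFactorisations (n : ℕ) : ℕ :=
  (unorderedFactorisations n).ncard

/-- The set of positive integers `n` such that `f(n)` divides `n`. -/
def setB : Set ℕ :=
  {n | 0 < n ∧ numFactorisations n ∣ n}

/-- The number of elements of a set `A` of natural numbers that are at most `x`. -/
noncomputable def countUpTo (A : Set ℕ) (x : ℝ) : ℕ :=
  {n : ℕ | n ∈ A ∧ (n : ℝ) ≤ x}.ncard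

/-!
Write `f` for `numFactorisations`, `ω(n)` for the number of primes dividing `n`, and `ℬ` for `setB`.
For a prime `f(p) = 1`, so `ℬ` contains the primes, and Chebyshev's bound gives
`#ℬ(x) ≫ x / log x`. It remains to show `#ℬ(x) ≪ x (log x) ^ (δ - 1)` for every `δ > 0`. Three
kinds of integers up to `N` are counted separately.

* Those with `ω(n) ≤ ε log log N` (`exists_card_few_primeFactors_le`). By Rankin's trick this
  reduces to `∑ z ^ ω(n)` for a small fixed `z`, which is `≪ (N / log N) ∑ z ^ ω(n) / n` because
  `log n = ∑_{d ∣ n} Λ(d)`; the last sum is a small power of `log N`, by its Euler product and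
  Mertens' estimate for `∑ 1 / p`.
* Those divisible by `q²` for some `q > log N`: there are `≪ N / log N` of them
  (`card_large_square_dvd_le`).
* All other `n ∈ ℬ`. Here `f(n)` is large: sharing out the remaining primes of `n` among `m` chosen
  ones shows `f(n) ≥ m ^ (ω(n) - m)` (`pow_le_numFactorisations`), which for a suitable fixed `m`
  exceeds a constant times `(log N) ^ 4`. But `f` depends only on the exponents in the prime
  factorisation. Writing `n = q² s` with `s` squarefree, they are determined up to order by `q`,
  `gcd(q, s)` and `ω(s / gcd(q, s))`, so only `O((log N) ^ 3)` values of `f` occur. Each value `v`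
  divides the `n` at which it is taken, and is therefore taken at most `N / v` times
  (`card_dvd_numFactorisations_le`).
-/

/-! ### Values and lower bounds of the factorisation function -/

/-- Adjoining the factor `n / d` embeds the factorisations of `d` into those of `n`. -/
theorem numFactorisations_le_of_dvd {d n : ℕ} (hn : n ≠ 0) (h : d ∣ n) :
    numFactorisations d ≤ numFactorisations n := by
  obtain ⟨c, rfl⟩ := h
  rcases eq_or_ne c 1 with rfl | hc
  · simp
  have hc0 : c ≠ 0 := right_ne_zero_of_mul hn
  refine Set.ncard_le_ncard_of_injOn (fun s => c ::ₘ s) ?_ ?_ (unorderedFactorisations_finite _)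
  · rintro s ⟨h1, rfl⟩
    refine ⟨fun a ha => ?_, by simp [mul_comm]⟩
    rcases Multiset.mem_cons.1 ha with rfl | ha
    · omega
    · exact h1 a ha
  · intro s _ t _ h
    exact (Multiset.cons_inj_right c).1 h

theorem numFactorisations_prime {p : ℕ} (hp : p.Prime) : numFactorisations p = 1 := by
  refine Set.ncard_eq_one.2 ⟨{p}, Set.eq_singleton_iff_unique_mem.2 ⟨⟨?_, by simp⟩, ?_⟩⟩
  · intro a ha
    rw [Multiset.mem_singleton.1 ha]
    exact hp.one_lt
  · rintro s ⟨h1, hs⟩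
    obtain ⟨a, ha⟩ : ∃ a, a ∈ s := by
      refine Multiset.exists_mem_of_ne_zero ?_
      rintro rfl
      exact hp.one_lt.ne (by simpa using hs)
    obtain ⟨t, rfl⟩ := Multiset.exists_cons_of_mem ha
    rw [Multiset.prod_cons] at hs
    have ha1 := h1 a ha
    have hap : a = p := (hp.eq_one_or_self_of_dvd a ⟨_, hs.symm⟩).resolve_left ha1.ne'
    have ht : t.prod = 1 := by
      subst hap
      exact Nat.eq_of_mul_eq_mul_left hp.pos (by simpa using hs)
    have : t = 0 := by
      by_contra h0
      obtain ⟨b, hb⟩ := Multiset.exists_mem_of_ne_zero h0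
      have := Nat.dvd_one.1 (ht ▸ Multiset.dvd_prod hb)
      have := h1 b (Multiset.mem_cons_of_mem hb)
      omega
    rw [this, hap]
    rfl

/-- Distribute the primes outside `A` among the primes in `A`: each map `g : P \ A → A` gives the
factorisation of `∏ p ∈ P, p` into the factors `a * ∏ q ∈ g⁻¹(a), q`, and `g` can be read off from
it. -/
theorem card_pow_le_numFactorisations_prod {P A : Finset ℕ} (hP : ∀ p ∈ P, p.Prime)
    (hA : A ⊆ P) : A.card ^ (P \ A).card ≤ numFactorisations (∏ p ∈ P, p) := by
  classical
  let F (g : ↥(P \ A) → ↥A) (a : ↥A) : ℕ := a * ∏ q : ↥(P \ A) with g q = a, (q : ℕ)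
  let M (g : ↥(P \ A) → ↥A) : Multiset ℕ := (Finset.univ : Finset ↥A).val.map (F g)
  have hpA (a : ↥A) : (a : ℕ).Prime := hP _ (hA a.2)
  have hpq (q : ↥(P \ A)) : (q : ℕ).Prime := hP _ (Finset.mem_sdiff.1 q.2).1
  have hne (a : ↥A) (q : ↥(P \ A)) : (a : ℕ) ≠ q := fun h =>
    (Finset.mem_sdiff.1 q.2).2 (h ▸ a.2)
  have hFpos (g a) : F g a ≠ 0 :=
    mul_ne_zero (hpA a).ne_zero (Finset.prod_ne_zero_iff.2 fun q _ => (hpq q).ne_zero)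
  -- a prime of `A` divides exactly one factor
  have hdvdA (g) (a b : ↥A) (h : (a : ℕ) ∣ F g b) : a = b := by
    rcases (hpA a).dvd_mul.1 h with h | h
    · exact Subtype.ext ((Nat.prime_dvd_prime_iff_eq (hpA a) (hpA b)).1 h)
    · obtain ⟨q, -, hq⟩ := (Prime.dvd_finsetProd_iff (hpA a).prime _).1 h
      exact absurd ((Nat.prime_dvd_prime_iff_eq (hpA a) (hpq q)).1 hq) (hne a q)
  have hdvdq (g) (q : ↥(P \ A)) (b : ↥A) (h : (q : ℕ) ∣ F g b) : g q = b := by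
    rcases (hpq q).dvd_mul.1 h with h | h
    · exact absurd ((Nat.prime_dvd_prime_iff_eq (hpq q) (hpA b)).1 h).symm (hne b q)
    · obtain ⟨q', hq', hq⟩ := (Prime.dvd_finsetProd_iff (hpq q).prime _).1 h
      have : q = q' := Subtype.ext ((Nat.prime_dvd_prime_iff_eq (hpq q) (hpq q')).1 hq)
      rw [this]
      exact (Finset.mem_filter.1 hq').2
  have hcard : A.card ^ (P \ A).card = (Set.univ : Set (↥(P \ A) → ↥A)).ncard := by
    rw [Set.ncard_univ, Nat.card_fun, Nat.card_eq_fintype_card, Nat.card_eq_fintype_card,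
      Fintype.card_coe, Fintype.card_coe]
  rw [hcard]
  refine Set.ncard_le_ncard_of_injOn M ?_ ?_ (unorderedFactorisations_finite _)
  · rintro g -
    refine ⟨fun x hx => ?_, ?_⟩
    · obtain ⟨a, -, rfl⟩ := Multiset.mem_map.1 hx
      exact (hpA a).one_lt.trans_le (Nat.le_of_dvd (Nat.pos_of_ne_zero (hFpos g a)) ⟨_, rfl⟩)
    · change ∏ a : ↥A, F g a = _
      rw [Finset.prod_mul_distrib, Finset.prod_fiberwise, Finset.prod_coe_sort A (fun p => p),
        Finset.prod_coe_sort (P \ A) (fun p => p), mul_comm, Finset.prod_sdiff hA]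
  · rintro g - g' - h
    funext q
    have hmem : F g (g q) ∈ M g' := by
      rw [← show M g = M g' from h]
      exact Multiset.mem_map_of_mem _ (Finset.mem_univ _)
    obtain ⟨b, -, hb⟩ := Multiset.mem_map.1 hmem
    have h1 : g q = b := hdvdA g' _ _ (hb ▸ ⟨_, rfl⟩)
    have h2 : (q : ℕ) ∣ F g (g q) :=
      Dvd.dvd.mul_left (Finset.dvd_prod_of_mem (fun q : ↥(P \ A) => (q : ℕ)) (by simp)) _
    rw [h1, hdvdq g' q b (hb ▸ h2)]

/-- Since `m` is free, `f(n)` exceeds any fixed exponential in `ω(n)`.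
This comes from the squarefree divisor `∏ p ∣ n, p`, with `m` of the primes distinguished. -/
theorem pow_le_numFactorisations {n : ℕ} (hn : n ≠ 0) {m : ℕ} (hm : m ≤ n.primeFactors.card) :
    m ^ (n.primeFactors.card - m) ≤ numFactorisations n := by
  obtain ⟨A, hA, rfl⟩ := Finset.exists_subset_card_eq hm
  rw [← Finset.card_sdiff_of_subset hA]
  exact (card_pow_le_numFactorisations_prod (fun p => Nat.prime_of_mem_primeFactors) hA).trans
    (numFactorisations_le_of_dvd hn (Nat.prod_primeFactors_dvd n))

/-! ### Invariance under permutations of the primes -/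

/-- The completely multiplicative map induced by a map `σ` on the primes (with value `1` at `0`). -/
def primeMap (σ : ℕ → ℕ) (n : ℕ) : ℕ :=
  ((n.primeFactorsList : Multiset ℕ).map σ).prod

theorem primeMap_mul (σ : ℕ → ℕ) {a b : ℕ} (ha : a ≠ 0) (hb : b ≠ 0) :
    primeMap σ (a * b) = primeMap σ a * primeMap σ b := by
  have h : ((a * b).primeFactorsList : Multiset ℕ) = a.primeFactorsList + b.primeFactorsList :=
    Multiset.coe_eq_coe.2 (Nat.perm_primeFactorsList_mul ha hb)
  rw [primeMap, h, Multiset.map_add, Multiset.prod_add, primeMap, primeMap]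

theorem primeMap_ne_zero {σ : ℕ → ℕ} (hσ : ∀ p, p.Prime → (σ p).Prime) (n : ℕ) :
    primeMap σ n ≠ 0 := by
  refine Multiset.prod_ne_zero fun h => ?_
  obtain ⟨p, hp, h0⟩ := Multiset.mem_map.1 h
  exact (hσ p (Nat.prime_of_mem_primeFactorsList (by simpa using hp))).ne_zero h0

theorem primeMap_primeMap {σ τ : ℕ → ℕ} (hσ : ∀ p, p.Prime → (σ p).Prime)
    (hτ : ∀ p, p.Prime → τ (σ p) = p) {n : ℕ} (hn : n ≠ 0) :
    primeMap τ (primeMap σ n) = n := by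
  have hp (p) (h : p ∈ n.primeFactorsList) : p.Prime := Nat.prime_of_mem_primeFactorsList h
  have h : ((primeMap σ n).primeFactorsList : Multiset ℕ) =
      (n.primeFactorsList : Multiset ℕ).map σ := by
    refine (Multiset.coe_eq_coe.2 (Nat.primeFactorsList_unique (l := n.primeFactorsList.map σ)
      (by simp [primeMap]) ?_)).symm
    intro q hq
    obtain ⟨p, hpm, rfl⟩ := List.mem_map.1 hq
    exact hσ p (hp p hpm)
  have h' : (n.primeFactorsList : Multiset ℕ).map (τ ∘ σ) =
      (n.primeFactorsList : Multiset ℕ).map id :=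
    Multiset.map_congr rfl fun p h => hτ p (hp p (by simpa using h))
  rw [primeMap, h, Multiset.map_map, h']
  simpa using Nat.prod_primeFactorsList hn

/-- A map on the primes with a left inverse transports factorisations injectively; it is applied
to a permutation of the primes and to its inverse. -/
theorem numFactorisations_le_primeMap {σ τ : ℕ → ℕ} (hσ : ∀ p, p.Prime → (σ p).Prime)
    (hτ : ∀ p, p.Prime → τ (σ p) = p) (n : ℕ) :
    numFactorisations n ≤ numFactorisations (primeMap σ n) := by
  have hinv {s : Multiset ℕ} (hs : ∀ a ∈ s, 1 < a) : (s.map (primeMap σ)).map (primeMap τ) = s := by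
    have h' : s.map (primeMap τ ∘ primeMap σ) = s.map id :=
      Multiset.map_congr rfl fun a h => primeMap_primeMap hσ hτ (Nat.ne_zero_of_lt (hs a h))
    rw [Multiset.map_map, h', Multiset.map_id]
  refine Set.ncard_le_ncard_of_injOn (Multiset.map (primeMap σ)) ?_ ?_
    (unorderedFactorisations_finite _)
  · rintro s ⟨h1, rfl⟩
    refine ⟨fun x hx => ?_, ?_⟩
    · obtain ⟨a, ha, rfl⟩ := Multiset.mem_map.1 hx
      have ha1 := h1 a ha
      have h0 := primeMap_ne_zero hσ a
      have h2 : primeMap σ a ≠ 1 := fun h => by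
        have := primeMap_primeMap hσ hτ (n := a) (by omega)
        rw [h] at this
        simp [primeMap] at this
        omega
      omega
    · clear hinv
      induction s using Multiset.induction with
      | empty => simp [primeMap]
      | cons a s ih =>
        have hs : ∀ b ∈ s, 1 < b := fun b hb => h1 b (Multiset.mem_cons_of_mem hb)
        have ha := h1 a (Multiset.mem_cons_self a s)
        rw [Multiset.map_cons, Multiset.prod_cons, ih hs, Multiset.prod_cons, primeMap_mul]
        · omega
        · exact Multiset.prod_ne_zero fun h => absurd (hs 0 h) (by omega)
  · intro s hs t ht h
    rw [← hinv hs.1, ← hinv ht.1]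
    exact congrArg _ h

/-- Sets of prime factors of equal size are matched by a permutation of the primes that moves no
other prime. -/
theorem exists_perm_primes {r r' : ℕ} (h : r.primeFactors.card = r'.primeFactors.card) :
    ∃ σ : Equiv.Perm ℕ, (∀ p, p.Prime → (σ p).Prime) ∧ (∀ p, p.Prime → (σ⁻¹ p).Prime) ∧
      r.primeFactors.image σ = r'.primeFactors ∧
      ∀ p, p ∉ r.primeFactors → p ∉ r'.primeFactors → σ p = p := by
  classical
  let S := r.primeFactors ∪ r'.primeFactors
  have hS : ∀ p ∈ S, p.Prime := fun p hp => by
    rcases Finset.mem_union.1 hp with hp | hp <;> exact Nat.prime_of_mem_primeFactors hp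
  have e0 : {x : ↥S // (x : ℕ) ∈ r.primeFactors} ≃ {x : ↥S // (x : ℕ) ∈ r'.primeFactors} := by
    refine (Equiv.subtypeSubtypeEquivSubtype fun h => ?_).trans
      ((Finset.equivOfCardEq h).trans (Equiv.subtypeSubtypeEquivSubtype fun h => ?_).symm)
    · exact Finset.mem_union_left _ h
    · exact Finset.mem_union_right _ h
  let e : Equiv.Perm ↥S := e0.extendSubtype
  have hmem (p : ℕ) (hp : p ∈ S) : Equiv.Perm.ofSubtype e p = e ⟨p, hp⟩ :=
    Equiv.Perm.ofSubtype_apply_of_mem e hp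
  have hprime (e : Equiv.Perm ↥S) (p : ℕ) (hp : p.Prime) : (Equiv.Perm.ofSubtype e p).Prime := by
    by_cases h : p ∈ S
    · rw [Equiv.Perm.ofSubtype_apply_of_mem e h]
      exact hS _ (e ⟨p, h⟩).2
    · rwa [Equiv.Perm.ofSubtype_apply_of_not_mem e h]
  refine ⟨Equiv.Perm.ofSubtype e, hprime e, ?_, ?_, ?_⟩
  · rw [← map_inv]
    exact hprime _
  · refine Finset.eq_of_subset_of_card_le ?_ ?_
    · intro q hq
      obtain ⟨p, hp, rfl⟩ := Finset.mem_image.1 hq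
      rw [hmem p (Finset.mem_union_left _ hp)]
      exact Equiv.extendSubtype_mem e0 ⟨p, Finset.mem_union_left _ hp⟩ hp
    · rw [Finset.card_image_of_injective _ (Equiv.injective _), h]
  · intro p h1 h2
    exact Equiv.Perm.ofSubtype_apply_of_not_mem e (by simp only [S, Finset.mem_union]; tauto)

/-- Of a squarefree part `r` coprime to the rest, `f` sees only the number of primes. -/
theorem numFactorisations_mul_eq {m r r' : ℕ} (hm : m ≠ 0) (hr : Squarefree r)
    (hr' : Squarefree r') (h : m.Coprime r) (h' : m.Coprime r')
    (hc : r.primeFactors.card = r'.primeFactors.card) :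
    numFactorisations (m * r) = numFactorisations (m * r') := by
  obtain ⟨σ, h1, h2, h3, h4⟩ := exists_perm_primes hc
  have hmr : m * r ≠ 0 := mul_ne_zero hm hr.ne_zero
  have key : primeMap σ (m * r) = m * r' := by
    rw [primeMap_mul _ hm hr.ne_zero]
    congr 1
    · rw [primeMap, Multiset.map_congr rfl (g := id)]
      · simpa using Nat.prod_primeFactorsList hm
      · intro p hp
        have hp : p ∈ m.primeFactors := by simpa using hp
        exact h4 p (Finset.disjoint_left.1 h.disjoint_primeFactors hp)
          (Finset.disjoint_left.1 h'.disjoint_primeFactors hp)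
    · rw [← Nat.prod_primeFactors_of_squarefree hr', ← h3,
        Finset.prod_image (σ.injective.injOn), primeMap]
      have hnd := (Nat.squarefree_iff_nodup_primeFactorsList hr.ne_zero).1 hr
      rw [Nat.primeFactors, List.prod_toFinset _ hnd]
      simp
  refine le_antisymm (key ▸ numFactorisations_le_primeMap (τ := ⇑σ⁻¹) h1 (by simp) _) ?_
  have := numFactorisations_le_primeMap (σ := ⇑σ⁻¹) (τ := σ) h2 (by simp) (primeMap σ (m * r))
  rwa [primeMap_primeMap h1 (by simp) hmr, key] at this

/-! ### Integers with few prime factors -/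

/-- A nonnegative `g` that can only decrease on passing to multiples satisfies
`∑_{n ≤ N} g n ≪ (N / log N) ∑_{n ≤ N} g n / n`. Writing `log n = ∑_{d ∣ n} Λ d`,
the inequality `g n ≤ g (n / d)` bounds `∑ g n log n` by a sum of Chebyshev's `ψ (N / n)`. -/
theorem sum_mul_log_le {g : ℕ → ℝ} (h0 : ∀ n, 0 ≤ g n)
    (hg : ∀ d n, d ∣ n → n ≠ 0 → g n ≤ g d) (N : ℕ) :
    (∑ n ∈ Finset.Ioc 0 N, g n) * Real.log N ≤
      (Real.log 4 + 5) * N * ∑ n ∈ Finset.Ioc 0 N, g n / n := by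
  let G : ArithmeticFunction ℝ := ⟨fun n => if n = 0 then 0 else g n, by simp⟩
  have hG {n : ℕ} (hn : n ≠ 0) : G n = g n := if_neg hn
  have h1 : ∑ n ∈ Finset.Ioc 0 N, g n * Real.log n ≤
      (Real.log 4 + 4) * N * ∑ n ∈ Finset.Ioc 0 N, g n / n := by
    calc ∑ n ∈ Finset.Ioc 0 N, g n * Real.log n
        ≤ ∑ n ∈ Finset.Ioc 0 N, (G * ArithmeticFunction.vonMangoldt) n := by
          refine Finset.sum_le_sum fun n hn => ?_
          have hn0 : n ≠ 0 := (Finset.mem_Ioc.1 hn).1.ne'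
          rw [ArithmeticFunction.mul_apply, ← ArithmeticFunction.vonMangoldt_sum, Finset.mul_sum,
            Nat.sum_divisorsAntidiagonal' (fun a b => G a * ArithmeticFunction.vonMangoldt b)]
          refine Finset.sum_le_sum fun d hd => ?_
          have hdn : n / d ∣ n := Nat.div_dvd_of_dvd (Nat.dvd_of_mem_divisors hd)
          rw [hG (ne_zero_of_dvd_ne_zero hn0 hdn)]
          exact mul_le_mul_of_nonneg_right (hg _ n hdn hn0) ArithmeticFunction.vonMangoldt_nonneg
      _ = ∑ n ∈ Finset.Ioc 0 N, g n * Chebyshev.psi ((N / n : ℕ) : ℝ) := by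
          rw [ArithmeticFunction.sum_Ioc_mul_eq_sum_sum]
          refine Finset.sum_congr rfl fun n hn => ?_
          rw [hG (Finset.mem_Ioc.1 hn).1.ne', Chebyshev.psi, Nat.floor_natCast]
      _ ≤ ∑ n ∈ Finset.Ioc 0 N, g n * ((Real.log 4 + 4) * (N / n)) := by
          refine Finset.sum_le_sum fun n _ => mul_le_mul_of_nonneg_left ?_ (h0 n)
          refine (Chebyshev.psi_le_const_mul_self (Nat.cast_nonneg _)).trans ?_
          exact mul_le_mul_of_nonneg_left Nat.cast_div_le (by positivity)
      _ = _ := by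
          rw [Finset.mul_sum]
          exact Finset.sum_congr rfl fun n _ => by ring
  have h2 : ∑ n ∈ Finset.Ioc 0 N, g n * (Real.log N - Real.log n) ≤
      N * ∑ n ∈ Finset.Ioc 0 N, g n / n := by
    rw [Finset.mul_sum]
    refine Finset.sum_le_sum fun n hn => ?_
    obtain ⟨hn0, hnN⟩ := Finset.mem_Ioc.1 hn
    have hn' : (0 : ℝ) < n := by exact_mod_cast hn0
    have hN' : (0 : ℝ) < N := by exact_mod_cast hn0.trans_le hnN
    rw [← Real.log_div hN'.ne' hn'.ne']
    calc g n * Real.log (N / n) ≤ g n * (N / n) :=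
          mul_le_mul_of_nonneg_left (Real.log_le_self (by positivity)) (h0 n)
      _ = _ := by ring
  have h3 : (∑ n ∈ Finset.Ioc 0 N, g n) * Real.log N = ∑ n ∈ Finset.Ioc 0 N, g n * Real.log n +
      ∑ n ∈ Finset.Ioc 0 N, g n * (Real.log N - Real.log n) := by
    rw [← Finset.sum_add_distrib, Finset.sum_mul]
    exact Finset.sum_congr rfl fun n _ => by ring
  rw [h3]
  linarith

theorem sum_one_div_primes_dyadic (k : ℕ) (hk : k ≠ 0) :
    ∑ p ∈ (Finset.Ioc (2 ^ k) (2 ^ (k + 1))).filter Nat.Prime, (1 : ℝ) / p ≤ 4 / k := by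
  have hk' : (0 : ℝ) < k := by exact_mod_cast Nat.pos_of_ne_zero hk
  have hl : 0 < Real.log 2 := Real.log_pos one_lt_two
  have h1 : (∑ p ∈ (Finset.Ioc (2 ^ k) (2 ^ (k + 1))).filter Nat.Prime, (1 : ℝ) / p) *
      (2 ^ k * (k * Real.log 2)) ≤ Real.log 4 * 2 ^ (k + 1) := by
    calc (∑ p ∈ (Finset.Ioc (2 ^ k) (2 ^ (k + 1))).filter Nat.Prime, (1 : ℝ) / p) *
          (2 ^ k * (k * Real.log 2))
        ≤ ∑ p ∈ (Finset.Ioc (2 ^ k) (2 ^ (k + 1))).filter Nat.Prime, Real.log p := by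
          rw [Finset.sum_mul]
          refine Finset.sum_le_sum fun p hp => ?_
          have hp1 : (2 : ℝ) ^ k ≤ p := by
            exact_mod_cast (Finset.mem_Ioc.1 (Finset.mem_filter.1 hp).1).1.le
          have hp0 : (0 : ℝ) < p := lt_of_lt_of_le (by positivity) hp1
          have hlog : k * Real.log 2 ≤ Real.log p := by
            rw [← Real.log_pow]
            exact Real.log_le_log (by positivity) hp1
          rw [one_div, inv_mul_le_iff₀ hp0]
          gcongr
      _ ≤ Chebyshev.theta ((2 ^ (k + 1) : ℕ) : ℝ) := by
          rw [Chebyshev.theta, Nat.floor_natCast]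
          refine Finset.sum_le_sum_of_subset_of_nonneg ?_ fun p _ _ => Real.log_natCast_nonneg p
          refine Finset.filter_subset_filter _ (Finset.Ioc_subset_Ioc_left (Nat.zero_le _))
      _ ≤ Real.log 4 * 2 ^ (k + 1) := by
          refine (Chebyshev.theta_le_log4_mul_x (Nat.cast_nonneg _)).trans_eq ?_
          push_cast
          rfl
  have h4 : Real.log 4 = 2 * Real.log 2 := by
    rw [show (4 : ℝ) = 2 ^ 2 by norm_num, Real.log_pow]
    norm_num
  rw [le_div_iff₀ hk']
  have h2 : (2 : ℝ) ^ k * Real.log 2 *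
      ((∑ p ∈ (Finset.Ioc (2 ^ k) (2 ^ (k + 1))).filter Nat.Prime, (1 : ℝ) / p) * k) ≤
      2 ^ k * Real.log 2 * 4 := by
    rw [h4, show (2 : ℝ) ^ (k + 1) = 2 ^ k * 2 from pow_succ 2 k] at h1
    linarith
  exact le_of_mul_le_mul_left h2 (by positivity)

theorem sum_one_div_primes_two_pow (K : ℕ) :
    ∑ p ∈ (Finset.Ioc 0 (2 ^ (K + 1))).filter Nat.Prime, (1 : ℝ) / p ≤ 1 + 4 * harmonic K := by
  induction K with
  | zero =>
    have : (Finset.Ioc 0 (2 ^ (0 + 1))).filter Nat.Prime = {2} := by decide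
    rw [this]
    norm_num
  | succ K ih =>
    rw [← Finset.Ioc_union_Ioc_eq_Ioc (Nat.zero_le (2 ^ (K + 1)))
      (Nat.pow_le_pow_right two_pos (Nat.le_succ (K + 1))), Finset.filter_union,
      Finset.sum_union (Finset.disjoint_filter_filter (Finset.Ioc_disjoint_Ioc_of_le le_rfl)),
      harmonic_succ]
    have := sum_one_div_primes_dyadic (K + 1) (Nat.succ_ne_zero K)
    push_cast at this ⊢
    rw [div_eq_mul_inv] at this
    linarith

/-- Mertens' upper bound for the sum of `1 / p`, up to a constant factor; any constant
will do here. -/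
theorem sum_one_div_primes_le {N : ℕ} (hN : 2 ≤ N) :
    ∑ p ∈ (Finset.Ioc 0 N).filter Nat.Prime, (1 : ℝ) / p ≤ 4 * Real.log (Real.log N) + 9 := by
  have hl : 0 < Real.log 2 := Real.log_pos one_lt_two
  have hlN : 0 < Real.log N := Real.log_pos (by exact_mod_cast hN)
  have hK : 0 < Nat.log 2 N := Nat.log_pos one_lt_two hN
  have hK' : (0 : ℝ) < Nat.log 2 N := by exact_mod_cast hK
  have h1 : Real.log (Nat.log 2 N) ≤ 1 + Real.log (Real.log N) := by
    have h2 : (Nat.log 2 N : ℝ) * Real.log 2 ≤ Real.log N := by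
      rw [← Real.log_pow]
      refine Real.log_le_log (by positivity) ?_
      exact_mod_cast Nat.pow_log_le_self 2 (by omega)
    have h3 : (Nat.log 2 N : ℝ) ≤ Real.exp 1 * Real.log N := by
      have := Real.log_two_gt_d9
      have := Real.exp_one_gt_d9
      nlinarith
    calc Real.log (Nat.log 2 N) ≤ Real.log (Real.exp 1 * Real.log N) := Real.log_le_log hK' h3
      _ = _ := by rw [Real.log_mul (Real.exp_pos 1).ne' hlN.ne', Real.log_exp]
  calc ∑ p ∈ (Finset.Ioc 0 N).filter Nat.Prime, (1 : ℝ) / p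
      ≤ ∑ p ∈ (Finset.Ioc 0 (2 ^ (Nat.log 2 N + 1))).filter Nat.Prime, (1 : ℝ) / p := by
        refine Finset.sum_le_sum_of_subset_of_nonneg ?_ fun p _ _ => by positivity
        exact Finset.filter_subset_filter _ (Finset.Ioc_subset_Ioc_right
          (Nat.lt_pow_succ_log_self one_lt_two N).le)
    _ ≤ 1 + 4 * harmonic (Nat.log 2 N) := sum_one_div_primes_two_pow _
    _ ≤ _ := by linarith [harmonic_le_one_add_log (Nat.log 2 N)]

/-- The partial sum of `z ^ ω(n) / n` is at most its Euler product over the primes up to `N`, where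
the factor at `p` is `1 + z / (p - 1) ≤ exp (2 z / p)`. -/
theorem sum_pow_card_primeFactors_div_le {z : ℝ} (hz : 0 ≤ z) (N : ℕ) :
    ∑ n ∈ Finset.Ioc 0 N, z ^ n.primeFactors.card / n ≤
      Real.exp (2 * z * ∑ p ∈ (Finset.Ioc 0 N).filter Nat.Prime, (1 : ℝ) / p) := by
  let f : ℕ → ℝ := fun n => z ^ n.primeFactors.card / n
  have hf0 (n) : 0 ≤ f n := by positivity
  have hf1 : f 1 = 1 := by simp [f]
  have hmul {m n : ℕ} (h : m.Coprime n) : f (m * n) = f m * f n := by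
    simp only [f]
    rw [h.primeFactors_mul, Finset.card_union_of_disjoint h.disjoint_primeFactors, pow_add]
    push_cast
    exact mul_div_mul_comm ..
  have hpow {p : ℕ} (hp : p.Prime) :
      HasSum (fun e : ℕ => f (p ^ e)) (1 + z * ((p : ℝ)⁻¹ * (1 - (p : ℝ)⁻¹)⁻¹)) := by
    have hp1 : (p : ℝ)⁻¹ < 1 := inv_lt_one_of_one_lt₀ (by exact_mod_cast hp.one_lt)
    have h : HasSum (fun e : ℕ => f (p ^ (e + 1))) (z * ((p : ℝ)⁻¹ * (1 - (p : ℝ)⁻¹)⁻¹)) := by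
      have he (e : ℕ) : f (p ^ (e + 1)) = z * ((p : ℝ)⁻¹ * (p : ℝ)⁻¹ ^ e) := by
        simp only [f]
        rw [Nat.primeFactors_prime_pow e.succ_ne_zero hp, Finset.card_singleton, pow_one,
          Nat.cast_pow, ← pow_succ', inv_pow, div_eq_mul_inv]
      simp only [he]
      exact ((hasSum_geometric_of_lt_one (by positivity) hp1).mul_left _).mul_left z
    simpa [hf1, add_comm] using (hasSum_nat_add_iff (f := fun e => f (p ^ e)) 1).1 h
  have hle {p : ℕ} (hp : p.Prime) :
      1 + z * ((p : ℝ)⁻¹ * (1 - (p : ℝ)⁻¹)⁻¹) ≤ Real.exp (2 * z * (1 / p)) := by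
    have hp2 : (p : ℝ)⁻¹ ≤ 2⁻¹ := inv_anti₀ two_pos (by exact_mod_cast hp.two_le)
    have h2 : (1 - (p : ℝ)⁻¹)⁻¹ ≤ 2 := by
      rw [inv_le_comm₀ (by linarith) two_pos]
      linarith
    have h3 : z * ((p : ℝ)⁻¹ * (1 - (p : ℝ)⁻¹)⁻¹) ≤ z * ((p : ℝ)⁻¹ * 2) := by gcongr
    have := Real.add_one_le_exp (2 * z * (1 / p))
    rw [one_div] at this ⊢
    linarith
  have hs := (EulerProduct.summable_and_hasSum_factoredNumbers_prod_filter_prime_tsum hf1 hmul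
    (fun hp => by
      simpa only [Real.norm_of_nonneg (hf0 _)] using (hpow hp).summable) (Finset.Ioc 0 N)).2
  have hmem (n : ℕ) (hn : n ∈ Finset.Ioc 0 N) : n ∈ Nat.factoredNumbers (Finset.Ioc 0 N) := by
    refine Nat.mem_factoredNumbers_of_primeFactors_subset (Finset.mem_Ioc.1 hn).1.ne' fun p hp => ?_
    exact Finset.mem_Ioc.2 ⟨Nat.pos_of_mem_primeFactors hp,
      (Nat.le_of_mem_primeFactors hp).trans (Finset.mem_Ioc.1 hn).2⟩
  calc ∑ n ∈ Finset.Ioc 0 N, f n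
      = ∑ n ∈ (Finset.Ioc 0 N).subtype (· ∈ Nat.factoredNumbers (Finset.Ioc 0 N)), f n :=
        (Finset.sum_subtype_of_mem f hmem).symm
    _ ≤ ∏ p ∈ (Finset.Ioc 0 N).filter Nat.Prime, ∑' e : ℕ, f (p ^ e) :=
        sum_le_hasSum _ (fun _ _ => hf0 _) hs
    _ ≤ ∏ p ∈ (Finset.Ioc 0 N).filter Nat.Prime, Real.exp (2 * z * (1 / p)) := by
        refine Finset.prod_le_prod (fun p _ => tsum_nonneg fun _ => hf0 _) fun p hp => ?_
        have hp := (Finset.mem_filter.1 hp).2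
        rw [(hpow hp).tsum_eq]
        exact hle hp
    _ = _ := by rw [← Real.exp_sum, Finset.mul_sum]

/-- Rankin's trick: each integer counted on the left has `z ^ t ≤ z ^ ω(n)`. -/
theorem card_few_primeFactors_mul_le {z : ℝ} (hz0 : 0 < z) (hz1 : z ≤ 1) {N : ℕ} (hN : 2 ≤ N)
    (t : ℝ) :
    (((Finset.Ioc 0 N).filter fun n => (n.primeFactors.card : ℝ) ≤ t).card : ℝ) * z ^ t *
      Real.log N ≤ (Real.log 4 + 5) * N * Real.exp (2 * z * (4 * Real.log (Real.log N) + 9)) := by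
  have h1 : (((Finset.Ioc 0 N).filter fun n => (n.primeFactors.card : ℝ) ≤ t).card : ℝ) * z ^ t ≤
      ∑ n ∈ Finset.Ioc 0 N, z ^ n.primeFactors.card := by
    rw [← nsmul_eq_mul, ← Finset.sum_const]
    refine (Finset.sum_le_sum fun n hn => ?_).trans
      (Finset.sum_le_sum_of_subset_of_nonneg (Finset.filter_subset _ _) fun n _ _ => by positivity)
    rw [← Real.rpow_natCast]
    exact Real.rpow_le_rpow_of_exponent_ge hz0 hz1 (Finset.mem_filter.1 hn).2
  have h2 := sum_mul_log_le (g := fun n => z ^ n.primeFactors.card) (fun n => by positivity)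
    (fun d n hd hn => pow_le_pow_of_le_one hz0.le hz1
      (Finset.card_le_card (Nat.primeFactors_mono hd hn))) N
  have h3 : ∑ n ∈ Finset.Ioc 0 N, z ^ n.primeFactors.card / n ≤
      Real.exp (2 * z * (4 * Real.log (Real.log N) + 9)) := by
    refine (sum_pow_card_primeFactors_div_le hz0.le N).trans (Real.exp_le_exp.2 ?_)
    exact mul_le_mul_of_nonneg_left (sum_one_div_primes_le hN) (by positivity)
  have hl : 0 ≤ Real.log N := Real.log_natCast_nonneg N
  refine (mul_le_mul_of_nonneg_right h1 hl).trans (h2.trans ?_)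
  exact mul_le_mul_of_nonneg_left h3 (by positivity)

/-- Integers with at most `ε log log N` prime factors are scarcely more numerous than primes:
at most `C N (log N) ^ (δ - 1)` of them up to `N`. -/
theorem exists_card_few_primeFactors_le {δ : ℝ} (hδ : 0 < δ) :
    ∃ ε > 0, ∃ C : ℝ, ∀ N : ℕ, 3 ≤ N →
      (((Finset.Ioc 0 N).filter fun n =>
        (n.primeFactors.card : ℝ) ≤ ε * Real.log (Real.log N)).card : ℝ) ≤
        C * (N * Real.exp ((δ - 1) * Real.log (Real.log N))) := by
  obtain ⟨z, hz0, hz1, hzδ⟩ : ∃ z : ℝ, 0 < z ∧ z ≤ 1 ∧ 8 * z ≤ δ / 2 :=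
    ⟨min 1 (δ / 16), by positivity, min_le_left _ _, by linarith [min_le_right 1 (δ / 16)]⟩
  have hlz : Real.log z ≤ 0 := Real.log_nonpos hz0.le hz1
  -- `ε log (1 / z) ≤ δ / 2` and `8 z ≤ δ / 2` keep each of the two losses below `(log N) ^ (δ / 2)`
  refine ⟨δ / (2 * (1 - Real.log z)), div_pos hδ (by linarith),
    (Real.log 4 + 5) * Real.exp 18, fun N hN => ?_⟩
  set ε := δ / (2 * (1 - Real.log z)) with hε
  have hε' : ε * (-Real.log z) ≤ δ / 2 := by
    rw [hε, div_mul_eq_mul_div, div_le_iff₀ (by linarith)]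
    nlinarith
  have hN3 : (3 : ℝ) ≤ N := by exact_mod_cast hN
  have hL : 1 ≤ Real.log N := by
    rw [Real.le_log_iff_exp_le (by linarith)]
    linarith [Real.exp_one_lt_d9]
  set l := Real.log (Real.log N) with hl
  have hl0 : 0 ≤ l := Real.log_nonneg hL
  have key := card_few_primeFactors_mul_le hz0 hz1 (N := N) (by omega) (ε * l)
  rw [Real.rpow_def_of_pos hz0, mul_assoc,
    show Real.log N = Real.exp l from (Real.exp_log (zero_lt_one.trans_le hL)).symm,
    Real.log_exp, ← Real.exp_add, ← le_div_iff₀ (Real.exp_pos _)] at key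
  refine key.trans ?_
  rw [div_le_iff₀ (Real.exp_pos _)]
  have h18 : 2 * z * (4 * l + 9) ≤
      18 + ((δ - 1) * l + (Real.log z * (ε * l) + l)) := by
    nlinarith [mul_le_mul_of_nonneg_right hε' hl0, mul_le_mul_of_nonneg_right hzδ hl0]
  calc (Real.log 4 + 5) * N * Real.exp (2 * z * (4 * l + 9))
      ≤ (Real.log 4 + 5) * N * Real.exp (18 + ((δ - 1) * l + (Real.log z * (ε * l) + l))) := by
        gcongr
    _ = _ := by
        rw [Real.exp_add, Real.exp_add]
        ring

/-! ### Integers divisible by a large square -/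

open Classical in
theorem card_large_square_dvd_le {Q : ℕ} (hQ : Q ≠ 0) (N : ℕ) :
    (((Finset.Ioc 0 N).filter fun n => ∃ q, Q < q ∧ q ^ 2 ∣ n).card : ℝ) ≤ N / Q := by
  have hsub : ((Finset.Ioc 0 N).filter fun n => ∃ q, Q < q ∧ q ^ 2 ∣ n) ⊆
      (Finset.Ioc Q N).biUnion fun q => (Finset.Ioc 0 N).filter (q ^ 2 ∣ ·) := by
    intro n hn
    obtain ⟨hn, q, hq, hd⟩ := Finset.mem_filter.1 hn
    obtain ⟨hn0, hnN⟩ := Finset.mem_Ioc.1 hn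
    refine Finset.mem_biUnion.2 ⟨q, Finset.mem_Ioc.2 ⟨hq, ?_⟩, Finset.mem_filter.2 ⟨hn, hd⟩⟩
    exact ((Nat.le_self_pow two_ne_zero q).trans (Nat.le_of_dvd hn0 hd)).trans hnN
  calc (((Finset.Ioc 0 N).filter fun n => ∃ q, Q < q ∧ q ^ 2 ∣ n).card : ℝ)
      ≤ ∑ q ∈ Finset.Ioc Q N, (((Finset.Ioc 0 N).filter (q ^ 2 ∣ ·)).card : ℝ) := by
        exact_mod_cast (Finset.card_le_card hsub).trans Finset.card_biUnion_le
    _ ≤ ∑ q ∈ Finset.Ioc Q N, N * ((q : ℝ) ^ 2)⁻¹ := by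
        refine Finset.sum_le_sum fun q _ => ?_
        rw [Nat.Ioc_filter_dvd_card_eq_div, ← div_eq_mul_inv]
        exact_mod_cast Nat.cast_div_le
    _ ≤ N / Q := by
        rw [← Finset.mul_sum, div_eq_mul_inv]
        refine mul_le_mul_of_nonneg_left ?_ (Nat.cast_nonneg N)
        rcases le_total Q N with h | h
        · refine (sum_Ioc_inv_sq_le_sub hQ h).trans ?_
          linarith [show (0 : ℝ) ≤ (N : ℝ)⁻¹ by positivity]
        · rw [Finset.Ioc_eq_empty (by omega), Finset.sum_empty]
          positivity

/-! ### Integers with many prime factors -/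

/-- If `n = q² s` with `s` squarefree, take `d = gcd(q, s)` and `r = s / d`. By
`numFactorisations_mul_eq`, `q`, `d` and `ω(r)` determine `f(n)`. -/
theorem exists_sq_mul_mul {n : ℕ} (hn : n ≠ 0) : ∃ q d r : ℕ, q ^ 2 * d * r = n ∧ d ∣ q ∧
    Squarefree r ∧ (q ^ 2 * d).Coprime r := by
  obtain ⟨s, q, rfl, hs⟩ := Nat.sq_mul_squarefree n
  obtain ⟨r, hr⟩ := Nat.gcd_dvd_right q s
  have hs' : Squarefree (q.gcd s * r) := hr ▸ hs
  have hdr : (q.gcd s).Coprime r := Nat.coprime_of_squarefree_mul hs'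
  have hqr : q.Coprime r := by
    refine Nat.coprime_of_dvd fun p hp hpq hpr => ?_
    have hps : p ∣ s := hr ▸ hpr.mul_left _
    exact hp.one_lt.ne' (Nat.dvd_one.1 (hdr ▸ Nat.dvd_gcd (Nat.dvd_gcd hpq hps) hpr))
  exact ⟨q, q.gcd s, r, by rw [mul_assoc, ← hr], Nat.gcd_dvd_left q s, hs'.of_mul_right,
    (hqr.pow_left 2).mul_left hdr⟩

theorem card_primeFactors_le_log {r N : ℕ} (hr : r ≠ 0) (h : r ≤ N) :
    r.primeFactors.card ≤ Nat.log 2 N := by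
  refine (Nat.le_log_iff_pow_le one_lt_two (by omega)).2 ?_
  calc 2 ^ r.primeFactors.card ≤ ∏ p ∈ r.primeFactors, p :=
        Finset.pow_card_le_prod _ _ _ fun p hp => (Nat.prime_of_mem_primeFactors hp).two_le
    _ ≤ r := Nat.le_of_dvd (Nat.pos_of_ne_zero hr) (Nat.prod_primeFactors_dvd r)
    _ ≤ N := h

/-- If every square dividing an element of `X` is at most `Q²`, then `f` takes few values on `X`,
one for each triple `(q, d, ω(r))` at most. Each value `v ≥ V` divides all the integers at which it is
taken, so it is taken at most `N / V` times. -/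
theorem card_dvd_numFactorisations_le {X : Finset ℕ} {N Q : ℕ} {V : ℝ} (hV : 0 < V)
    (hX : ∀ n ∈ X, n ≠ 0 ∧ n ≤ N ∧ numFactorisations n ∣ n ∧ V ≤ numFactorisations n)
    (hQ : ∀ n ∈ X, ∀ q, q ^ 2 ∣ n → q ≤ Q) :
    (X.card : ℝ) ≤ N / V * ((Q + 1) ^ 2 * (Nat.log 2 N + 1)) := by
  have hdec (n : ℕ) : ∃ q d r : ℕ, n ≠ 0 → q ^ 2 * d * r = n ∧ d ∣ q ∧
      Squarefree r ∧ (q ^ 2 * d).Coprime r := by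
    by_cases hn : n = 0
    · exact ⟨0, 0, 0, fun h => absurd hn h⟩
    · obtain ⟨q, d, r, h⟩ := exists_sq_mul_mul hn
      exact ⟨q, d, r, fun _ => h⟩
  choose q d r h using hdec
  let key (n : ℕ) : ℕ × ℕ × ℕ := (q n, d n, (r n).primeFactors.card)
  let T : Finset (ℕ × ℕ × ℕ) :=
    Finset.range (Q + 1) ×ˢ Finset.range (Q + 1) ×ˢ Finset.range (Nat.log 2 N + 1)
  have hmaps : ∀ n ∈ X, key n ∈ T := by
    intro n hn
    obtain ⟨hn0, hnN, -, -⟩ := hX n hn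
    obtain ⟨h1, h2, h3, -⟩ := h n hn0
    have hq : q n ≤ Q := hQ n hn _ ⟨d n * r n, by rw [← mul_assoc, h1]⟩
    have hq0 : q n ≠ 0 := fun h0 => hn0 (by rw [← h1, h0]; simp)
    have hd : d n ≤ Q := (Nat.le_of_dvd (Nat.pos_of_ne_zero hq0) h2).trans hq
    have hr : r n ≤ N :=
      (Nat.le_of_dvd (Nat.pos_of_ne_zero hn0) ⟨_, by rw [mul_comm, h1]⟩).trans hnN
    have hω := card_primeFactors_le_log h3.ne_zero hr
    simp only [T, key, Finset.mem_product, Finset.mem_range]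
    omega
  have hkey (n n' : ℕ) (hn : n ≠ 0) (hn' : n' ≠ 0) (he : key n = key n') :
      numFactorisations n = numFactorisations n' := by
    obtain ⟨h1, -, h3, h4⟩ := h n hn
    obtain ⟨h1', -, h3', h4'⟩ := h n' hn'
    simp only [key, Prod.mk.injEq] at he
    obtain ⟨hq, hd, hω⟩ := he
    rw [← h1, ← h1', ← hq, ← hd]
    rw [← hq, ← hd] at h4'
    refine numFactorisations_mul_eq ?_ h3 h3' h4 h4' hω
    intro h0
    rw [h0, zero_mul] at h1
    exact hn h1.symm
  have hfib : ∀ κ ∈ T, ((X.filter fun n => key n = κ).card : ℝ) ≤ N / V := by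
    intro κ _
    rcases (X.filter fun n => key n = κ).eq_empty_or_nonempty with h0 | ⟨n₀, hn₀⟩
    · rw [h0, Finset.card_empty, Nat.cast_zero]
      positivity
    obtain ⟨hn₀X, hn₀κ⟩ := Finset.mem_filter.1 hn₀
    obtain ⟨hn₀0, -, -, hV₀⟩ := hX n₀ hn₀X
    have hsub : (X.filter fun n => key n = κ) ⊆
        (Finset.Ioc 0 N).filter (numFactorisations n₀ ∣ ·) := by
      intro n hn
      obtain ⟨hnX, hnκ⟩ := Finset.mem_filter.1 hn
      obtain ⟨hn0, hnN, hdvd, -⟩ := hX n hnX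
      refine Finset.mem_filter.2 ⟨Finset.mem_Ioc.2 ⟨Nat.pos_of_ne_zero hn0, hnN⟩, ?_⟩
      rwa [hkey n₀ n hn₀0 hn0 (hn₀κ.trans hnκ.symm)]
    calc ((X.filter fun n => key n = κ).card : ℝ)
        ≤ ((N / numFactorisations n₀ : ℕ) : ℝ) := by
          rw [← Nat.Ioc_filter_dvd_card_eq_div]
          exact_mod_cast Finset.card_le_card hsub
      _ ≤ N / numFactorisations n₀ := Nat.cast_div_le
      _ ≤ N / V := by gcongr
  rw [Finset.card_eq_sum_card_fiberwise hmaps, Nat.cast_sum]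
  refine (Finset.sum_le_card_nsmul _ _ _ hfib).trans_eq ?_
  simp only [T, Finset.card_product, Finset.card_range, nsmul_eq_mul]
  push_cast
  ring

/-- With `l = log log N`: integers with more than `ε log log N` prime factors have
`f(n) ≥ c (log N) ^ A`, for any `A`. -/
theorem log_pow_le_numFactorisations {ε : ℝ} (hε : 0 < ε) (A : ℝ) :
    ∃ c > 0, ∀ᶠ l : ℝ in atTop, ∀ n : ℕ, n ≠ 0 → ε * l < n.primeFactors.card →
      c * Real.exp (A * l) ≤ numFactorisations n := by
  -- `m ^ (ε l) ≥ exp (A l)` as soon as `ε log m ≥ A`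
  obtain ⟨m, hm⟩ := exists_nat_ge (Real.exp (|A| / ε))
  have hm1 : (1 : ℝ) ≤ m := (Real.one_le_exp (by positivity)).trans hm
  have hm0 : (0 : ℝ) < m := zero_lt_one.trans_le hm1
  have hA : A ≤ Real.log m * ε := by
    rw [← div_le_iff₀ hε]
    exact (div_le_div_of_nonneg_right (le_abs_self A) hε.le).trans
      ((Real.le_log_iff_exp_le hm0).2 hm)
  refine ⟨(m : ℝ) ^ (-(m : ℝ)), by positivity, ?_⟩
  filter_upwards [eventually_ge_atTop 0, eventually_ge_atTop (m / ε)] with l hl0 hl n hn hω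
  rw [div_le_iff₀ hε, mul_comm] at hl
  have hmω : m ≤ n.primeFactors.card := by exact_mod_cast hl.trans hω.le
  calc (m : ℝ) ^ (-(m : ℝ)) * Real.exp (A * l)
      ≤ (m : ℝ) ^ (-(m : ℝ)) * (m : ℝ) ^ (ε * l) := by
        rw [Real.rpow_def_of_pos hm0 (ε * l), ← mul_assoc]
        gcongr
    _ = (m : ℝ) ^ (ε * l - m) := by
        rw [← Real.rpow_add hm0]
        ring_nf
    _ ≤ (m : ℝ) ^ ((n.primeFactors.card - m : ℕ) : ℝ) := by
        refine Real.rpow_le_rpow_of_exponent_le hm1 ?_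
        rw [Nat.cast_sub hmω]
        linarith
    _ ≤ numFactorisations n := by
        rw [Real.rpow_natCast]
        exact_mod_cast pow_le_numFactorisations hn hmω

/-! ### The counting function -/

theorem tendsto_log_log : Tendsto (fun x : ℝ => Real.log (Real.log x)) atTop atTop :=
  Real.tendsto_log_atTop.comp Real.tendsto_log_atTop

open Classical in
theorem exists_card_setB_le {δ : ℝ} (hδ : 0 < δ) :
    ∃ C : ℝ, ∀ᶠ N : ℕ in atTop, (((Finset.Ioc 0 N).filter (· ∈ setB)).card : ℝ) ≤
      C * (N * Real.exp ((δ - 1) * Real.log (Real.log N))) := by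
  obtain ⟨ε, hε, C, hC⟩ := exists_card_few_primeFactors_le hδ
  -- the triples `(q, d, ω(r))` with `q ≤ log N` number `O((log N) ^ 3)`; the exponent `4` beats
  -- this by one factor `log N`
  obtain ⟨c, hc, hev⟩ := log_pow_le_numFactorisations hε 4
  refine ⟨C + 2 + 12 / c, ?_⟩
  filter_upwards [eventually_ge_atTop 3,
    (tendsto_log_log.comp tendsto_natCast_atTop_atTop).eventually hev] with N hN hbig
  simp only [Function.comp_apply] at hbig
  have hN3 : (3 : ℝ) ≤ N := by exact_mod_cast hN
  have hL : 1 ≤ Real.log N := by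
    rw [Real.le_log_iff_exp_le (by linarith)]
    linarith [Real.exp_one_lt_d9]
  have hLpos : 0 < Real.log N := zero_lt_one.trans_le hL
  have h1 := hC N hN
  set L := Real.log N with hLdef
  have hl0 : 0 ≤ Real.log L := Real.log_nonneg hL
  have hexp4 : Real.exp (4 * Real.log L) = L ^ 4 := by
    rw [mul_comm, ← Real.rpow_def_of_pos hLpos]
    norm_cast
  rw [hexp4] at hbig
  -- `1 / L` is below the target order of magnitude
  have hinv : L⁻¹ ≤ Real.exp ((δ - 1) * Real.log L) := by
    rw [← Real.exp_log hLpos, ← Real.exp_neg, Real.exp_log hLpos]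
    refine Real.exp_le_exp.2 ?_
    nlinarith [mul_nonneg hδ.le hl0]
  have hNinv : N * L⁻¹ ≤ N * Real.exp ((δ - 1) * Real.log L) := by gcongr
  set Q := ⌊L⌋₊ with hQdef
  have hQ1 : 1 ≤ Q := Nat.le_floor (by simpa using hL)
  have hQL : (Q : ℝ) ≤ L := Nat.floor_le hLpos.le
  have hLQ : L ≤ 2 * Q := by
    have := Nat.lt_floor_add_one L
    have : (1 : ℝ) ≤ Q := by exact_mod_cast hQ1
    linarith
  have h2 : (((Finset.Ioc 0 N).filter fun n => ∃ q, Q < q ∧ q ^ 2 ∣ n).card : ℝ) ≤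
      2 * (N * L⁻¹) := by
    refine (card_large_square_dvd_le (by omega) N).trans ?_
    rw [div_le_iff₀ (by exact_mod_cast hQ1)]
    calc (N : ℝ) = N * L⁻¹ * L := by field_simp
      _ ≤ N * L⁻¹ * (2 * Q) := by gcongr
      _ = _ := by ring
  let X := (Finset.Ioc 0 N).filter fun n =>
    n ∈ setB ∧ (ε * Real.log L < n.primeFactors.card) ∧ ∀ q, q ^ 2 ∣ n → q ≤ Q
  have h3 : (X.card : ℝ) ≤ 12 / c * (N * L⁻¹) := by
    have h := card_dvd_numFactorisations_le (X := X) (N := N) (Q := Q) (V := c * L ^ 4)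
      (by positivity)
      (fun n hn => by
        obtain ⟨hn, hB, hω, -⟩ := Finset.mem_filter.1 hn
        exact ⟨hB.1.ne', (Finset.mem_Ioc.1 hn).2, hB.2, hbig n hB.1.ne' hω⟩)
      (fun n hn => (Finset.mem_filter.1 hn).2.2.2)
    have hlog : (Nat.log 2 N : ℝ) ≤ 2 * L := by
      have h2 : (Nat.log 2 N : ℝ) * Real.log 2 ≤ L := by
        rw [← Real.log_pow]
        refine Real.log_le_log (by positivity) ?_
        exact_mod_cast Nat.pow_log_le_self 2 (by omega)
      have := Real.log_two_gt_d9
      have : (0 : ℝ) ≤ Nat.log 2 N := Nat.cast_nonneg _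
      nlinarith
    refine h.trans ?_
    calc (N : ℝ) / (c * L ^ 4) * ((Q + 1) ^ 2 * (Nat.log 2 N + 1))
        ≤ N / (c * L ^ 4) * ((L + L) ^ 2 * (2 * L + L)) := by gcongr
      _ = _ := by
        field_simp
        norm_num
  have hsub : (Finset.Ioc 0 N).filter (· ∈ setB) ⊆
      ((Finset.Ioc 0 N).filter fun n => (n.primeFactors.card : ℝ) ≤ ε * Real.log L) ∪
        ((Finset.Ioc 0 N).filter fun n => ∃ q, Q < q ∧ q ^ 2 ∣ n) ∪ X := by
    intro n hn
    obtain ⟨hn, hB⟩ := Finset.mem_filter.1 hn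
    simp only [X, Finset.mem_union, Finset.mem_filter, hn, hB, true_and]
    by_cases h1 : (n.primeFactors.card : ℝ) ≤ ε * Real.log L
    · exact Or.inl (Or.inl h1)
    by_cases h2 : ∃ q, Q < q ∧ q ^ 2 ∣ n
    · exact Or.inl (Or.inr h2)
    push Not at h1 h2
    exact Or.inr ⟨h1, fun q hq => not_lt.1 fun hlt => h2 q hlt hq⟩
  have hcard : (((Finset.Ioc 0 N).filter (· ∈ setB)).card : ℝ) ≤
      (((Finset.Ioc 0 N).filter fun n => (n.primeFactors.card : ℝ) ≤ ε * Real.log L).card : ℝ) +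
        (((Finset.Ioc 0 N).filter fun n => ∃ q, Q < q ∧ q ^ 2 ∣ n).card : ℝ) + X.card := by
    have := (Finset.card_le_card hsub).trans
      ((Finset.card_union_le _ _).trans (Nat.add_le_add_right (Finset.card_union_le _ _) _))
    exact_mod_cast this
  have h4 : 12 / c * (N * L⁻¹) ≤ 12 / c * (N * Real.exp ((δ - 1) * Real.log L)) := by gcongr
  linarith

open Classical in
theorem countUpTo_eq_card {A : Set ℕ} (hA : 0 ∉ A) {x : ℝ} (hx : 0 ≤ x) :
    countUpTo A x = ((Finset.Ioc 0 ⌊x⌋₊).filter (· ∈ A)).card := by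
  rw [countUpTo, ← Set.ncard_coe_finset]
  congr 1
  ext n
  simp only [Set.mem_ofPred_eq, Finset.coe_filter, Finset.mem_Ioc, Nat.le_floor_iff hx]
  refine ⟨fun h => ⟨⟨Nat.pos_of_ne_zero fun h0 => hA (h0 ▸ h.1), h.2⟩, h.1⟩,
    fun h => ⟨h.2, h.1.2⟩⟩

theorem zero_notMem_setB : 0 ∉ setB := fun h => h.1.ne rfl

theorem exists_countUpTo_setB_le {δ : ℝ} (hδ : 0 < δ) (hδ1 : δ ≤ 1) :
    ∃ C > 0, ∀ᶠ x : ℝ in atTop,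
      (countUpTo setB x : ℝ) ≤ C * (x * Real.exp ((δ - 1) * Real.log (Real.log x))) := by
  classical
  obtain ⟨C, hC⟩ := exists_card_setB_le hδ
  refine ⟨2 * (|C| + 1), by positivity, ?_⟩
  filter_upwards [tendsto_nat_floor_atTop.eventually hC, eventually_ge_atTop 16] with x hx hx16
  rw [countUpTo_eq_card zero_notMem_setB (by linarith)]
  have hN : ((⌊x⌋₊ : ℕ) : ℝ) ≤ x := Nat.floor_le (by linarith)
  have hxN : x / 2 ≤ (⌊x⌋₊ : ℝ) := by linarith [Nat.lt_floor_add_one x]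
  have hlogx : 0 < Real.log x := Real.log_pos (by linarith)
  have hlogN : Real.log x / 2 ≤ Real.log (⌊x⌋₊ : ℝ) := by
    have h1 : Real.log (x / 2) ≤ Real.log (⌊x⌋₊ : ℝ) := Real.log_le_log (by linarith) hxN
    rw [Real.log_div (by linarith) two_ne_zero] at h1
    have h2 : Real.log ((2 : ℝ) ^ 2) ≤ Real.log x :=
      Real.log_le_log (by norm_num) (by linarith)
    rw [Real.log_pow] at h2
    push_cast at h2
    linarith
  have hll : Real.log (Real.log x) - Real.log 2 ≤ Real.log (Real.log (⌊x⌋₊ : ℝ)) := by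
    rw [← Real.log_div hlogx.ne' two_ne_zero]
    exact Real.log_le_log (by positivity) hlogN
  -- the exponent `δ - 1` is nonpositive, so the lower bound for `log ⌊x⌋` is the one needed
  have hexp : Real.exp ((δ - 1) * Real.log (Real.log (⌊x⌋₊ : ℝ))) ≤
      2 * Real.exp ((δ - 1) * Real.log (Real.log x)) := by
    nth_rewrite 1 [← Real.exp_log (two_pos : (0 : ℝ) < 2)]
    rw [← Real.exp_add]
    refine Real.exp_le_exp.2 ?_
    have : 0 < Real.log 2 := Real.log_pos one_lt_two
    nlinarith [mul_le_mul_of_nonneg_left hll (sub_nonneg.2 hδ1)]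
  calc _ ≤ C * ((⌊x⌋₊ : ℝ) * Real.exp ((δ - 1) * Real.log (Real.log (⌊x⌋₊ : ℝ)))) := hx
    _ ≤ (|C| + 1) * (x * (2 * Real.exp ((δ - 1) * Real.log (Real.log x)))) := by
        gcongr
        linarith [le_abs_self C]
    _ = _ := by ring

/-- The primes belong to the set, since `f(p) = 1`. -/
theorem le_countUpTo_setB {x : ℝ} (hx : 30 ≤ x) :
    x / (2 * Real.log x) ≤ (countUpTo setB x : ℝ) := by
  classical
  have hlogx : 0 < Real.log x := Real.log_pos (by linarith)
  have hπ : Nat.primeCounting ⌊x⌋₊ ≤ countUpTo setB x := by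
    rw [countUpTo_eq_card zero_notMem_setB (by linarith), ← Nat.primesLE_card_eq_primeCounting]
    refine Finset.card_le_card fun p hp => ?_
    rw [Nat.mem_primesLE] at hp
    refine Finset.mem_filter.2 ⟨Finset.mem_Ioc.2 ⟨hp.2.pos, hp.1⟩, hp.2.pos, ?_⟩
    rw [numFactorisations_prime hp.2]
    exact one_dvd p
  have h1 := Chebyshev.pi_ge' (x := x) (by linarith)
  have h2 : Real.log (x + 2) ≤ x / 16 + 2 := by
    have h3 := Real.log_le_sub_one_of_pos (x := (x + 2) / 16) (by linarith)
    have h4 : Real.log 16 = 4 * Real.log 2 := by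
      rw [show (16 : ℝ) = 2 ^ 4 by norm_num, Real.log_pow]
      norm_num
    rw [Real.log_div (by linarith) (by norm_num), h4] at h3
    linarith [Real.log_two_lt_d9]
  calc x / (2 * Real.log x) = x / 2 / Real.log x := by rw [div_div]
    _ ≤ ((x - 1) * Real.log 2 - Real.log (x + 2)) / Real.log x := by
        gcongr
        nlinarith [Real.log_two_gt_d9]
    _ ≤ Nat.primeCounting ⌊x⌋₊ := h1
    _ ≤ _ := by exact_mod_cast hπ

theorem theorem3 :
    ∃ ε : ℝ → ℝ, Tendsto ε atTop (𝓝 0) ∧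
      ∀ᶠ x : ℝ in atTop,
        (countUpTo setB x : ℝ) = x / (Real.log x) ^ (1 + ε x) := by
  have hpos {x : ℝ} (hx : 30 ≤ x) : (0 : ℝ) < countUpTo setB x := by
    have : 0 < Real.log x := Real.log_pos (by linarith)
    exact lt_of_lt_of_le (by positivity) (le_countUpTo_setB hx)
  refine ⟨fun x => Real.log (x / countUpTo setB x) / Real.log (Real.log x) - 1, ?_, ?_⟩
  · rw [Metric.tendsto_nhds]
    intro η hη
    have hδ : 0 < min 1 (η / 2) := by positivity
    obtain ⟨C, hC0, hC⟩ := exists_countUpTo_setB_le hδ (min_le_left _ _)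
    have hδη : min 1 (η / 2) ≤ η / 2 := min_le_right _ _
    set δ := min 1 (η / 2)
    filter_upwards [hC, eventually_ge_atTop 30,
      tendsto_log_log.eventually (eventually_gt_atTop 0),
      tendsto_log_log.eventually (eventually_gt_atTop (Real.log 2 / η)),
      tendsto_log_log.eventually (eventually_gt_atTop (Real.log C / (η / 2)))] with
      x hxC hx hl h2 h3
    have hx0 : 0 < x := by linarith
    have hc := hpos hx
    have hlogx : 0 < Real.log x := Real.log_pos (by linarith)
    rw [div_lt_iff₀ hη] at h2
    rw [div_lt_iff₀ (by positivity)] at h3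
    have hup : Real.log (x / countUpTo setB x) ≤ Real.log (Real.log x) + Real.log 2 := by
      rw [← Real.log_mul hlogx.ne' two_ne_zero]
      refine Real.log_le_log (by positivity) ?_
      have h := le_countUpTo_setB hx
      rw [div_le_iff₀ (by positivity)] at h
      rw [div_le_iff₀ hc]
      linarith
    have hlow : (1 - δ) * Real.log (Real.log x) - Real.log C ≤
        Real.log (x / countUpTo setB x) := by
      have h := Real.log_le_log hc hxC
      rw [Real.log_mul hC0.ne' (by positivity), Real.log_mul hx0.ne' (Real.exp_pos _).ne',
        Real.log_exp] at h
      rw [Real.log_div hx0.ne' hc.ne']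
      linarith
    rw [Real.dist_eq, sub_zero, abs_lt]
    constructor
    · rw [lt_sub_iff_add_lt, lt_div_iff₀ hl]
      nlinarith [mul_le_mul_of_nonneg_right hδη hl.le]
    · rw [sub_lt_iff_lt_add, div_lt_iff₀ hl]
      nlinarith
  · filter_upwards [eventually_ge_atTop 30,
      tendsto_log_log.eventually (eventually_gt_atTop 0)] with x hx hl
    have hc := hpos hx
    have hx0 : 0 < x := by linarith
    have hlogx : 0 < Real.log x := Real.log_pos (by linarith)
    rw [add_sub_cancel, Real.rpow_def_of_pos hlogx, mul_div_cancel₀ _ hl.ne',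
      Real.exp_log (by positivity)]
    field_simp
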